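/- A storage type is a tuple $S=(C,P,F,c_0)$ with a set $C$ of configurations, a non-empty set $P$ of predicates $p\colon C\to\{0,1\}$, a non-empty set $F$ of partial functions $f\colon C\rightharpoonup C$ (instructions), and an initial configuration $c_0\in C$. Call $S$ effective if $P$ and $F$ are finite and, for some coding of $C$ by natural numbers, all $p\in P$ are computable and all $f\in F$ are computable with decidable domain. A ranked alphabet $\Sigma$ is a finite set with a rank function such that some symbol has rank $0$; $T_\Sigma$ is the set of trees over $\Sigma$. Let $\mathbb B=(\{0,1\},\vee,0,\Omega)$ be the Boolean M-monoid, where $\Omega^{(k)}=\{0_k,\mathrm{all}_k\}$, $0_k$ is the $k$-ary constant zero function, $\mathrm{all}_k(a_1,\dots,a_k)=1$ iff $a_1=\dots=a_k=1$, and countable sums are disjunctions. An $(S,\Sigma,\mathbb B)$-rtg is a tuple $\mathcal G=(N,Z,R,\mathrm{wt})$ with a finite set $N$ of nonterminals disjoint from $\Sigma$, a set $Z\subseteq N$, a finite non-empty set $R$ of rules of the forms $A(p)\to\sigma(A_1(f_1),\dots,A_k(f_k))$ and $A(p)\to B(f)$ (with $A,B,A_i\in N$, $p\in P$, $f,f_i\in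 F$, $\sigma\in\Sigma$ of rank $k$), and a function $\mathrm{wt}$ that maps each rule with $k$ nonterminals on its right-hand side to an element of $\Omega^{(k)}$. A derivation tree of $\mathcal G$ for $\xi\in T_\Sigma$ is a tree $d$ over $R$ (a rule with $k$ nonterminals on its right-hand side having rank $k$) such that the rule at the root has its left-hand side nonterminal in $Z$; the nonterminals on the right-hand side of the rule at each node are the left-hand side nonterminals of the rules at its children; the terminal symbols of the rules in $d$ form $\xi$ (nodes with rules $A(p)\to B(f)$ being skipped); and the nodes of $d$ can be assigned configurations so that the root gets $c_0$ and, at each node with configuration $c$, predicate $p$ and instructions $f_1,\dots,f_k$ of its rule, $p(c)=1$ and the $i$-th child gets the configuration $f_i(c)$, which is defined. The weight $\mathrm{wt}(d)\in\{0,1\}$ is the value obtained by evaluating the operations $\mathrm{wt}(r)$ of the rules $r$ in $d$ bottom-up, $[\![\mathcal G]\!](\xi)=\bigvee_d\mathrm{wt}(d)$ over all derivation trees $d$ of $\mathcal G$ for $\xi$, and $\mathrm{supp}([\![\mathcal G]\!])=\{\xi\in T_\Sigma\mid[\![\mathcal G]\!](\xi)\neq0\}$. Lemma. There are an effective storage type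 $S$ and a ranked alphabet $\Sigma$ for which the empty-support problem for $(S,\Sigma,\mathbb B)$-rtg is undecidable: whatever injective names in $\mathbb N$ are given to the elements of $P$, $F$ and $\Sigma$, there is no algorithm that, given (the finite description of) an arbitrary $(S,\Sigma,\mathbb B)$-rtg $\mathcal G$, decides whether $\mathrm{supp}([\![\mathcal G]\!])=\emptyset$. -/

import Mathlib

namespace WRTG

/-! ### Ranked alphabets and trees -/

/-- A ranked alphabet: a finite set of symbols with ranks, among them a symbol of rank `0`
(so that the alphabet is non-empty and there is a tree over it). -/
structure RankedAlphabet where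
  carrier : Type
  finite : Finite carrier
  rk : carrier → ℕ
  exists_rank_zero : ∃ a, rk a = 0

/-- The set of trees over a set `A` of symbols with rank function `rk`: the tree
`WType.mk a ts` is `a(ts 0, …, ts (rk a - 1))`. -/
abbrev Tree {A : Type} (rk : A → ℕ) : Type := WType (fun a : A => Fin (rk a))

/-- The label at the root of a tree. -/
def rootLabel {A : Type} {rk : A → ℕ} : Tree rk → A
  | ⟨a, _⟩ => a

/-- There are only countably many trees over a countable set of symbols. -/
instance Tree.instCountable {A : Type} [Countable A] (rk : A → ℕ) : Countable (Tree rk) := by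
  have : Encodable A := Encodable.ofCountable A
  infer_instance

/-! ### Storage types -/

/-- A storage type `(C, P, F, c₀)`: configurations, a non-empty set of total predicates on `C`,
a non-empty set of partial functions `C → C` (undefined is `none`), and an initial
configuration. -/
structure StorageType where
  C : Type
  P : Set (C → Bool)
  F : Set (C → Option C)
  c₀ : C
  P_nonempty : P.Nonempty
  F_nonempty : F.Nonempty

/-- A finitely generated computable storage type: finitely many predicates and instructions, and,
for some coding of the configurations, all predicates are computable, and so are all
instructions, together with their domains. -/
def StorageType.IsEffective (S : StorageType) : Prop :=
  S.P.Finite ∧ S.F.Finite ∧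
    ∃ _ : Primcodable S.C, (∀ p ∈ S.P, Computable p) ∧ (∀ f ∈ S.F, Computable f)

/-- Labels `(p, f₁ … f_k)` of behaviours. -/
def StorageType.Label (S : StorageType) : Type := Σ k : ℕ, S.P × (Fin k → S.F)

/-- The rank of the label `(p, f₁ … f_k)` is `k`. -/
def StorageType.Label.rank {S : StorageType} (l : S.Label) : ℕ := l.1

/-- `b` is a behaviour starting in the configuration `c`: its nodes can be labelled by
configurations such that the root gets `c` and, at a node with label `(p, f₁ … f_k)` and
configuration `c'`, the predicate `p` holds on `c'` and the `i`-th child gets the configuration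
`f_i(c')`, which has to be defined. -/
def StorageType.IsBehaviour (S : StorageType) :
    Tree (StorageType.Label.rank (S := S)) → S.C → Prop
  | ⟨l, bs⟩, c =>
      l.2.1.1 c = true ∧ ∀ i, ∃ c', (l.2.2 i).1 c = some c' ∧ S.IsBehaviour (bs i) c'

/-! ### Complete multioperator monoids -/

/-- A complete M-monoid: a commutative monoid with sums over all countable index sets that
extend the finite sums and satisfy the partition law, together with, for every `k`, a set `Ω k`
of `k`-ary operations that contains the constant zero function and consists of operations that
are zero as soon as one argument is zero. -/
structure CompleteMMonoid where
  carrier : Type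
  addCommMonoid : AddCommMonoid carrier
  sum : ∀ {I : Type} [Countable I], (I → carrier) → carrier
  sum_finite : ∀ {I : Type} [Fintype I] (a : I → carrier), sum a = ∑ i, a i
  sum_partition : ∀ {I J : Type} [Countable I] [Countable J] (φ : I → J) (a : I → carrier),
    sum a = sum (fun j : J => sum (fun i : {i : I // φ i = j} => a i.1))
  Ω : ∀ k : ℕ, Set ((Fin k → carrier) → carrier)
  zero_mem : ∀ k, (fun _ => 0) ∈ Ω k
  absorptive : ∀ k, ∀ ω ∈ Ω k, ∀ a : Fin k → carrier, (∃ i, a i = 0) → ω a = 0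

instance (K : CompleteMMonoid) : AddCommMonoid K.carrier := K.addCommMonoid

/-- The commutative monoid `({0,1}, ∨, 0)`. -/
@[reducible] def orMonoid : AddCommMonoid Bool where
  add a b := a || b
  add_assoc := Bool.or_assoc
  zero := false
  zero_add := Bool.false_or
  add_zero := Bool.or_false
  add_comm := Bool.or_comm
  nsmul := @nsmulRec Bool ⟨false⟩ ⟨fun a b => a || b⟩

open Classical in
/-- The disjunction of a family of truth values. -/
noncomputable def bigOr {I : Type} (a : I → Bool) : Bool := decide (∃ i, a i = true)

theorem bigOr_eq_true {I : Type} (a : I → Bool) : bigOr a = true ↔ ∃ i, a i = true := by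
  simp [bigOr]

theorem orMonoid_sum_eq_true {I : Type} (s : Finset I) (a : I → Bool) :
    @Finset.sum I Bool orMonoid s a = true ↔ ∃ i ∈ s, a i = true := by
  classical
  induction s using Finset.induction_on with
  | empty =>
    rw [@Finset.sum_empty I Bool a orMonoid]
    constructor
    · intro h
      exact absurd h Bool.false_ne_true
    · rintro ⟨i, hi, _⟩
      simp at hi
  | insert j s hj ih =>
    rw [@Finset.sum_insert I Bool s j orMonoid a _ hj]
    have : ∀ x y : Bool, @HAdd.hAdd Bool Bool Bool (@instHAdd Bool orMonoid.toAdd) x y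
        = (x || y) := fun _ _ => rfl
    rw [this, Bool.or_eq_true, ih]
    simp

/-- The `k`-ary operation on `{0,1}` with value `1` exactly if all arguments are `1`. -/
noncomputable def allOp (k : ℕ) (a : Fin k → Bool) : Bool := by
  classical exact decide (∀ i, a i = true)

/-- The Boolean M-monoid `({0,1}, ∨, 0, Ω)` with `Ω k = {0_k, all_k}`, and with the
disjunctions of countable families as sums. -/
noncomputable def boolMMonoid : CompleteMMonoid where
  carrier := Bool
  addCommMonoid := orMonoid
  sum a := bigOr a
  sum_finite {I} _ a := by
    rw [Bool.eq_iff_iff, bigOr_eq_true, orMonoid_sum_eq_true]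
    simp
  sum_partition φ a := by
    rw [Bool.eq_iff_iff, bigOr_eq_true, bigOr_eq_true]
    constructor
    · rintro ⟨i, hi⟩
      exact ⟨φ i, (bigOr_eq_true _).2 ⟨⟨i, rfl⟩, hi⟩⟩
    · rintro ⟨j, hj⟩
      obtain ⟨i, hi⟩ := (bigOr_eq_true _).1 hj
      exact ⟨i.1, hi⟩
  Ω k := {fun _ => false, allOp k}
  zero_mem k := Or.inl rfl
  absorptive k ω hω a := by
    rintro ⟨i, hi⟩
    rcases hω with rfl | rfl
    · rfl
    · change allOp k a = false
      have hi' : a i = false := hi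
      simp only [allOp, decide_eq_false_iff_not]
      intro h
      simp [h i] at hi'

/-! ### Weighted regular tree grammars with storage -/

/-- Rules: `A(p) → σ(A₁(f₁), …, A_k(f_k))` with `σ` of rank `k`, and chain rules `A(p) → B(f)`. -/
inductive Rule (S : StorageType) (Γ : RankedAlphabet) (N : Type) : Type
  | symbol (A : N) (p : S.P) (σ : Γ.carrier) (args : Fin (Γ.rk σ) → N × S.F)
  | chain (A : N) (p : S.P) (arg : N × S.F)

namespace Rule

variable {S : StorageType} {Γ : RankedAlphabet} {N : Type}

/-- The number of nonterminals on the right-hand side. -/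
def rank : Rule S Γ N → ℕ
  | symbol _ _ σ _ => Γ.rk σ
  | chain _ _ _ => 1

/-- The nonterminal on the left-hand side. -/
def lhs : Rule S Γ N → N
  | symbol A _ _ _ => A
  | chain A _ _ => A

/-- The predicate on the left-hand side. -/
def pred : Rule S Γ N → S.P
  | symbol _ p _ _ => p
  | chain _ p _ => p

/-- The terminal symbol on the right-hand side, if there is one. -/
def sym : Rule S Γ N → Option Γ.carrier
  | symbol _ _ σ _ => some σ
  | chain _ _ _ => none

/-- The nonterminals, with their instructions, on the right-hand side. -/
def rhs : (r : Rule S Γ N) → Fin r.rank → N × S.F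
  | symbol _ _ _ args => args
  | chain _ _ arg => fun _ => arg

/-- The label `(p, f₁ … f_k)` of a rule. -/
def label (r : Rule S Γ N) : S.Label := ⟨r.rank, r.pred, fun i => (r.rhs i).2⟩

end Rule

/-- An `(S, Γ, K)`-rtg `(N, Z, R, wt)`. Nonterminals and terminal symbols are of different
types, hence disjoint. -/
structure RTG (S : StorageType) (Γ : RankedAlphabet) (K : CompleteMMonoid) where
  N : Type
  N_finite : Finite N
  Z : Set N
  R : Set (Rule S Γ N)
  R_finite : R.Finite
  R_nonempty : R.Nonempty
  wt : (r : R) → K.Ω r.1.rank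

namespace RTG

variable {S : StorageType} {Γ : RankedAlphabet} {K : CompleteMMonoid} (G : RTG S Γ K)

/-- Trees over the set of rules. -/
abbrev RTree : Type := Tree (fun r : G.R => r.1.rank)

instance : Countable G.RTree :=
  haveI : Finite G.R := G.R_finite
  Tree.instCountable _

/-- The tree over `Γ` that is retrieved from a tree over the rules. -/
def proj : G.RTree → Tree Γ.rk
  | ⟨⟨.symbol _ _ σ _, _⟩, ds⟩ => ⟨σ, fun i => proj (ds i)⟩
  | ⟨⟨.chain _ _ _, _⟩, ds⟩ => proj (ds (0 : Fin 1))

/-- The relabelling of a tree over the rules by the labels `(p, f₁ … f_k)`. -/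
def beh : G.RTree → Tree (StorageType.Label.rank (S := S))
  | ⟨r, ds⟩ => ⟨r.1.label, fun i => beh (ds i)⟩

/-- At every node, the nonterminals on the right-hand side of the rule are the left-hand side
nonterminals of the rules at the children. -/
def Matches : G.RTree → Prop
  | ⟨r, ds⟩ => ∀ i, (r.1.rhs i).1 = (rootLabel (ds i)).1.lhs ∧ Matches (ds i)

/-- The set of `(N', c)`-derivation trees for `ξ`. -/
def derivations (N' : Set G.N) (ξ : Tree Γ.rk) (c : S.C) : Set G.RTree :=
  {d | (rootLabel d).1.lhs ∈ N' ∧ G.proj d = ξ ∧ G.Matches d ∧ S.IsBehaviour (G.beh d) c}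

/-- The weight of a tree over the rules. -/
def weight : G.RTree → K.carrier
  | ⟨r, ds⟩ => (G.wt r).1 (fun i => weight (ds i))

/-- The weighted tree language generated by `G`. -/
def sem (ξ : Tree Γ.rk) : K.carrier :=
  K.sum (fun d : G.derivations G.Z ξ S.c₀ => G.weight d.1)

end RTG

/-- The support of a weighted tree language. -/
def supp {Γ : RankedAlphabet} {K : CompleteMMonoid} (s : Tree Γ.rk → K.carrier) :
    Set (Tree Γ.rk) := {ξ | s ξ ≠ 0}

/-! ### The empty-support problem -/

/-- Numbers as names for predicates, instructions, and terminal symbols. -/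
structure Naming (S : StorageType) (Γ : RankedAlphabet) where
  pred : S.P ↪ ℕ
  instr : S.F ↪ ℕ
  sym : Γ.carrier ↪ ℕ

/-- The code of a rule: left-hand side nonterminal, predicate, terminal symbol (if any), and the
list of nonterminals and instructions on the right-hand side. -/
abbrev RuleCode : Type := ℕ × ℕ × Option ℕ × List (ℕ × ℕ)

/-- The code of a grammar with weights in the Boolean M-monoid: the number of nonterminals, a list
of the initial ones, and a list of the rules with their weights (`true` for `all_k`, `false` for
`0_k`). -/
abbrev GrammarCode : Type := ℕ × List ℕ × List (RuleCode × Bool)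

/-- The code of a rule, given numbers for the nonterminals. -/
def Rule.code {S : StorageType} {Γ : RankedAlphabet} {N : Type} (nm : Naming S Γ) (ν : N → ℕ)
    (r : Rule S Γ N) : RuleCode :=
  (ν r.lhs, nm.pred r.pred, r.sym.map nm.sym,
    List.ofFn fun i => (ν (r.rhs i).1, nm.instr (r.rhs i).2))

/-- `x` is a code of the grammar `G`, for some numbering of the nonterminals. -/
def Codes {S : StorageType} {Γ : RankedAlphabet} (nm : Naming S Γ) (x : GrammarCode)
    (G : RTG S Γ boolMMonoid) : Prop :=
  ∃ ν : G.N ≃ Fin x.1,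
    (∀ m, m ∈ x.2.1 ↔ ∃ A ∈ G.Z, (ν A : ℕ) = m) ∧
    (∀ e, e ∈ x.2.2 ↔ ∃ r : G.R,
      e.1 = r.1.code nm (fun A => (ν A : ℕ)) ∧ (e.2 = true ↔ (G.wt r).1 = allOp r.1.rank))

/-- The empty-support problem for `(S, Γ, 𝔹)`-rtg is decidable: some total computable function
decides, given any code of any `(S, Γ, 𝔹)`-rtg `G`, whether the support of the weighted tree
language generated by `G` is empty. -/
def EmptySupportDecidable (S : StorageType) (Γ : RankedAlphabet) (nm : Naming S Γ) : Prop :=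
  ∃ δ : GrammarCode → Bool, Computable δ ∧
    ∀ (x : GrammarCode) (G : RTG S Γ boolMMonoid), Codes nm x G →
      (δ x = true ↔ supp G.sem = ∅)

end WRTG

namespace WRTG

open Nat.Partrec (Code)

/-! ### A storage type for program simulation

A configuration `(n, k)` consists of a program number `n` and a time bound `k`. -/

/-! The halting problem is undecidable, but halting within a given time is computable, so the latter
can serve as a storage predicate. The storage is fixed while the program varies, so the grammar must
carry the program: its `n + 1` nonterminals form a chain that counts the first component from `0` up
to `n`. The last nonterminal then raises the time bound arbitrarily often and may stop only at a
bound at which program `n` has halted. All weights are `all_k`, so the support is non-empty exactly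
when some derivation tree exists, that is, when program `n` halts on `0`
(`supp_simGrammar_eq_empty_iff`). A code of this grammar is primitive recursive in `n`
(`primrec_simCode`), so deciding emptiness would decide non-halting. -/

/-- The predicate that holds on every configuration. -/
def alwaysPred : ℕ × ℕ → Bool := fun _ => true

/-- The program with number `n` halts on input `0` within the time bound `k`. -/
def haltsPred : ℕ × ℕ → Bool := fun c => (Code.evaln c.2 (Denumerable.ofNat Code c.1) 0).isSome

/-- Increment the program number. -/
def incProgram : ℕ × ℕ → Option (ℕ × ℕ) := fun c => some (c.1 + 1, c.2)

/-- Increment the time bound. -/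
def incTime : ℕ × ℕ → Option (ℕ × ℕ) := fun c => some (c.1, c.2 + 1)

/-- The storage type of pairs of a program number and a time bound. -/
def simStorage : StorageType where
  C := ℕ × ℕ
  P := {alwaysPred, haltsPred}
  F := {incProgram, incTime}
  c₀ := (0, 0)
  P_nonempty := ⟨alwaysPred, Or.inl rfl⟩
  F_nonempty := ⟨incProgram, Or.inl rfl⟩

theorem computable_haltsPred : Computable haltsPred := by
  have h : Primrec fun c : ℕ × ℕ => Code.evaln c.2 (Denumerable.ofNat Code c.1) 0 :=
    Code.primrec_evaln.comp
      (Primrec.pair (Primrec.pair Primrec.snd ((Primrec.ofNat Code).comp Primrec.fst))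
        (Primrec.const 0))
  exact (Primrec.option_isSome.comp h).to_comp

theorem computable_alwaysPred : Computable alwaysPred := Computable.const true

theorem computable_incProgram : Computable incProgram :=
  (Primrec.option_some.comp (Primrec.pair (Primrec.succ.comp Primrec.fst) Primrec.snd)).to_comp

theorem computable_incTime : Computable incTime :=
  (Primrec.option_some.comp (Primrec.pair Primrec.fst (Primrec.succ.comp Primrec.snd))).to_comp

theorem simStorage_isEffective : simStorage.IsEffective := by
  refine ⟨Set.toFinite {alwaysPred, haltsPred}, Set.toFinite {incProgram, incTime},
    (inferInstance : Primcodable (ℕ × ℕ)), ?_, ?_⟩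
  · rintro p (rfl | rfl)
    · exact computable_alwaysPred
    · exact computable_haltsPred
  · rintro f (rfl | rfl)
    · exact computable_incProgram
    · exact computable_incTime

/-- The ranked alphabet with a single symbol, of rank `0`. -/
def unitAlphabet : RankedAlphabet where
  carrier := Unit
  finite := inferInstance
  rk _ := 0
  exists_rank_zero := ⟨(), rfl⟩

/-- `alwaysPred` as a predicate of `simStorage`. -/
def always : simStorage.P := ⟨alwaysPred, Or.inl rfl⟩

/-- `haltsPred` as a predicate of `simStorage`. -/
def halts : simStorage.P := ⟨haltsPred, Or.inr rfl⟩

/-- `incProgram` as an instruction of `simStorage`. -/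
def nextProgram : simStorage.F := ⟨incProgram, Or.inl rfl⟩

/-- `incTime` as an instruction of `simStorage`. -/
def nextTime : simStorage.F := ⟨incTime, Or.inr rfl⟩

/-! ### The grammar that simulates a program -/

/-- The rule that moves from nonterminal `i` to `i + 1` and increments the program number. -/
def loadRule (n : ℕ) (i : Fin n) : Rule simStorage unitAlphabet (Fin (n + 1)) :=
  .chain i.castSucc always (i.succ, nextProgram)

/-- The rule that stays in the last nonterminal and increments the time bound. -/
def waitRule (n : ℕ) : Rule simStorage unitAlphabet (Fin (n + 1)) :=
  .chain (Fin.last n) always (Fin.last n, nextTime)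

/-- The terminating rule, applicable once the simulated program has halted. -/
def stopRule (n : ℕ) : Rule simStorage unitAlphabet (Fin (n + 1)) :=
  .symbol (Fin.last n) halts () Fin.elim0

/-- The grammar that loads the number `n` and then searches for a time bound within which the
program with number `n` halts on input `0`. -/
noncomputable def simGrammar (n : ℕ) : RTG simStorage unitAlphabet boolMMonoid where
  N := Fin (n + 1)
  N_finite := inferInstance
  Z := {0}
  R := Set.range (loadRule n) ∪ {waitRule n, stopRule n}
  R_finite := (Set.finite_range _).union (Set.toFinite _)
  R_nonempty := ⟨waitRule n, Or.inr (Or.inl rfl)⟩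
  wt r := ⟨allOp r.1.rank, Or.inr rfl⟩

theorem allOp_eq_true {k : ℕ} {a : Fin k → Bool} (h : ∀ i, a i = true) : allOp k a = true := by
  simpa only [allOp, decide_eq_true_eq] using h

theorem simGrammar_weight (n : ℕ) (d : (simGrammar n).RTree) :
    (simGrammar n).weight d = true := by
  induction d with
  | mk r ds ih =>
    change allOp r.1.rank (fun i => (simGrammar n).weight (ds i)) = true
    exact allOp_eq_true ih

/-- Some derivation tree with nonterminal `A` at the root can be run from the configuration `c`. -/
def Derivable {S : StorageType} {Γ : RankedAlphabet} {K : CompleteMMonoid} (G : RTG S Γ K)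
    (A : G.N) (c : S.C) : Prop :=
  ∃ d : G.RTree, (rootLabel d).1.lhs = A ∧ G.Matches d ∧ S.IsBehaviour (G.beh d) c

/-- Every derivation tree has weight `1` and is one for its own projection, so neither weights nor
the generated tree matter from here on. -/
theorem supp_simGrammar_nonempty_iff (n : ℕ) :
    (supp (simGrammar n).sem).Nonempty ↔ Derivable (simGrammar n) (0 : Fin (n + 1)) (0, 0) := by
  have key (ξ) : ξ ∈ supp (simGrammar n).sem ↔
      ∃ d : (simGrammar n).derivations (simGrammar n).Z ξ simStorage.c₀,
        (simGrammar n).weight d.1 = true := by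
    -- By definition, `sem` is a `bigOr` over derivations and the zero of the monoid is `false`.
    refine Iff.trans ?_ (bigOr_eq_true _)
    exact Bool.ne_false_iff
  constructor
  · rintro ⟨ξ, hξ⟩
    obtain ⟨⟨d, hd⟩, -⟩ := (key ξ).1 hξ
    exact ⟨d, hd.1, hd.2.2.1, hd.2.2.2⟩
  · rintro ⟨d, h1, h2, h3⟩
    exact ⟨(simGrammar n).proj d, (key _).2 ⟨⟨d, h1, rfl, h2, h3⟩, simGrammar_weight n d⟩⟩

theorem derivable_stop {n : ℕ} {c : ℕ × ℕ} (h : haltsPred c = true) :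
    Derivable (simGrammar n) (Fin.last n) c :=
  ⟨⟨⟨stopRule n, Or.inr (Or.inr rfl)⟩, Fin.elim0⟩, rfl, fun i => i.elim0, h, fun i => i.elim0⟩

theorem derivable_wait {n m k : ℕ} (h : Derivable (simGrammar n) (Fin.last n) (m, k + 1)) :
    Derivable (simGrammar n) (Fin.last n) (m, k) := by
  obtain ⟨d, h1, h2, h3⟩ := h
  exact ⟨⟨⟨waitRule n, Or.inr (Or.inl rfl)⟩, fun _ => d⟩, rfl, fun _ => ⟨h1.symm, h2⟩, rfl,
    fun _ => ⟨_, rfl, h3⟩⟩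

theorem derivable_load {n m k : ℕ} (i : Fin n)
    (h : Derivable (simGrammar n) i.succ (m + 1, k)) :
    Derivable (simGrammar n) i.castSucc (m, k) := by
  obtain ⟨d, h1, h2, h3⟩ := h
  exact ⟨⟨⟨loadRule n i, Or.inl ⟨i, rfl⟩⟩, fun _ => d⟩, rfl, fun _ => ⟨h1.symm, h2⟩, rfl,
    fun _ => ⟨_, rfl, h3⟩⟩

/-- The derivation is built from its leaf upwards: the stop rule at `(n, k)`, then `k` wait rules
back to `(n, 0)`, then `n` load rules back to `(0, 0)`. -/
theorem derivable_zero_of_halts {n k : ℕ} (h : haltsPred (n, k) = true) :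
    Derivable (simGrammar n) (0 : Fin (n + 1)) (0, 0) := by
  have hlast : Derivable (simGrammar n) (Fin.last n) (n, 0) := by
    have (j : ℕ) (hj : Derivable (simGrammar n) (Fin.last n) (n, j)) :
        Derivable (simGrammar n) (Fin.last n) (n, 0) := by
      induction j with
      | zero => exact hj
      | succ j ih => exact ih (derivable_wait hj)
    exact this k (derivable_stop h)
  have (i : Fin (n + 1)) : Derivable (simGrammar n) i (i.val, 0) := by
    induction i using Fin.reverseInduction with
    | last => exact hlast
    | cast i ih => exact derivable_load i ih
  exact this 0

/-- The invariant is that the program number equals the index of the nonterminal. Stopping is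
possible only in nonterminal `n`, so the program tested there is program `n`. -/
theorem exists_halts_of_derivation {n : ℕ} (d : (simGrammar n).RTree) :
    ∀ (i : Fin (n + 1)) (k : ℕ), (rootLabel d).1.lhs = i → (simGrammar n).Matches d →
      simStorage.IsBehaviour ((simGrammar n).beh d) (i.val, k) →
        ∃ k', haltsPred (n, k') = true := by
  induction d with
  | mk r ds ih =>
    obtain ⟨r, ⟨j, rfl⟩ | rfl | rfl⟩ := r
    · rintro i k rfl hm ⟨-, hb⟩
      obtain ⟨c', hc, hb⟩ := hb (0 : Fin 1)
      obtain rfl : ((j.val + 1, k) : ℕ × ℕ) = c' := Option.some.inj hc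
      exact ih (0 : Fin 1) j.succ k (hm (0 : Fin 1)).1.symm (hm (0 : Fin 1)).2 hb
    · rintro i k rfl hm ⟨-, hb⟩
      obtain ⟨c', hc, hb⟩ := hb (0 : Fin 1)
      obtain rfl : ((n, k + 1) : ℕ × ℕ) = c' := Option.some.inj hc
      exact ih (0 : Fin 1) (Fin.last n) (k + 1) (hm (0 : Fin 1)).1.symm (hm (0 : Fin 1)).2 hb
    · rintro i k rfl - ⟨hp, -⟩
      exact ⟨k, hp⟩

theorem supp_simGrammar_eq_empty_iff (n : ℕ) :
    supp (simGrammar n).sem = ∅ ↔ ¬ (Code.eval (Denumerable.ofNat Code n) 0).Dom := by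
  rw [← Set.not_nonempty_iff_eq_empty, supp_simGrammar_nonempty_iff, not_iff_not]
  have hdom : (Code.eval (Denumerable.ofNat Code n) 0).Dom ↔ ∃ k, haltsPred (n, k) = true := by
    simp only [haltsPred, Option.isSome_iff_exists, Part.dom_iff_mem, Code.evaln_complete,
      Option.mem_def]
    exact exists_comm
  rw [hdom]
  constructor
  · rintro ⟨d, h1, h2, h3⟩
    exact exists_halts_of_derivation d 0 0 h1 h2 h3
  · rintro ⟨k, hk⟩
    exact derivable_zero_of_halts hk

/-! ### The reduction from the halting problem -/

/-- The code of `simGrammar n`. -/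
def simCode (nm : Naming simStorage unitAlphabet) (n : ℕ) : GrammarCode :=
  (n + 1, [0],
    ((n, nm.pred always, none, [(n, nm.instr nextTime)]), true) ::
    ((n, nm.pred halts, some (nm.sym ()), []), true) ::
    (List.range n).map fun i =>
      ((i, nm.pred always, none, [(i + 1, nm.instr nextProgram)]), true))

theorem codes_simCode (nm : Naming simStorage unitAlphabet) (n : ℕ) :
    Codes nm (simCode nm n) (simGrammar n) := by
  refine ⟨Equiv.refl (Fin (n + 1)), fun m => ?_, fun e => ?_⟩
  · constructor
    · intro h
      exact ⟨(0 : Fin (n + 1)), rfl, (List.mem_singleton.1 h).symm⟩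
    · rintro ⟨A, rfl, rfl⟩
      exact List.mem_singleton.2 rfl
  · constructor
    · intro h
      obtain rfl | h := List.mem_cons.1 h
      · exact ⟨⟨waitRule n, Or.inr (Or.inl rfl)⟩, rfl, iff_of_true rfl rfl⟩
      obtain rfl | h := List.mem_cons.1 h
      · exact ⟨⟨stopRule n, Or.inr (Or.inr rfl)⟩, rfl, iff_of_true rfl rfl⟩
      obtain ⟨i, hi, rfl⟩ := List.mem_map.1 h
      exact ⟨⟨loadRule n ⟨i, List.mem_range.1 hi⟩, Or.inl ⟨_, rfl⟩⟩, rfl, iff_of_true rfl rfl⟩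
    · obtain ⟨e, b⟩ := e
      rintro ⟨⟨r, hr⟩, rfl, hb⟩
      obtain rfl : b = true := hb.2 rfl
      obtain ⟨j, rfl⟩ | rfl | rfl := hr
      · exact List.mem_cons_of_mem _ (List.mem_cons_of_mem _
          (List.mem_map.2 ⟨j.val, List.mem_range.2 j.isLt, rfl⟩))
      · exact List.mem_cons_self
      · exact List.mem_cons_of_mem _ List.mem_cons_self

/-- Only finitely many names occur, and they enter as constants; hence the naming may be arbitrary.
-/
theorem primrec_simCode (nm : Naming simStorage unitAlphabet) : Primrec (simCode nm) := by
  have hpair (a : ℕ) (f : ℕ → ℕ) (hf : Primrec f) : Primrec fun i => [(f i, a)] :=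
    Primrec.list_cons.comp (Primrec.pair hf (Primrec.const a)) (Primrec.const [])
  have hrule (a : ℕ) (s : Option ℕ) (l : ℕ → List (ℕ × ℕ)) (hl : Primrec l) :
      Primrec fun i : ℕ => (((i, a, s, l i), true) : RuleCode × Bool) :=
    Primrec.pair (Primrec.pair Primrec.id (Primrec.pair (Primrec.const a)
      (Primrec.pair (Primrec.const s) hl))) (Primrec.const true)
  refine Primrec.pair Primrec.succ (Primrec.pair (Primrec.const [0]) ?_)
  refine Primrec.list_cons.comp (hrule _ _ _ (hpair _ _ Primrec.id)) ?_
  refine Primrec.list_cons.comp (hrule _ _ _ (Primrec.const [])) ?_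
  exact Primrec.list_map Primrec.list_range
    ((hrule _ _ _ (hpair _ _ Primrec.succ)).comp Primrec.snd).to₂

theorem not_emptySupportDecidable_simStorage (nm : Naming simStorage unitAlphabet) :
    ¬ EmptySupportDecidable simStorage unitAlphabet nm := by
  rintro ⟨δ, hδ, h⟩
  -- Empty support means non-halting, which is not even recursively enumerable.
  refine ComputablePred.halting_problem_not_re 0 (ComputablePred.to_re ?_)
  refine ComputablePred.computable_iff.2
    ⟨fun c => δ (simCode nm (Encodable.encode c)),
      hδ.comp ((primrec_simCode nm).to_comp.comp Computable.encode), ?_⟩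
  funext c
  rw [h _ _ (codes_simCode nm _), supp_simGrammar_eq_empty_iff, Denumerable.ofNat_encode]

end WRTG

theorem mainTheorem12 :
    ∃ (S : WRTG.StorageType) (Γ : WRTG.RankedAlphabet),
      S.IsEffective ∧
        ∀ nm : WRTG.Naming S Γ, ¬ WRTG.EmptySupportDecidable S Γ nm :=
  ⟨WRTG.simStorage, WRTG.unitAlphabet, WRTG.simStorage_isEffective,
    WRTG.not_emptySupportDecidable_simStorage⟩
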